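/- Let $n,m\ge 0$. For $\mathbf{x}\in\mathbb{R}^n$ write $|\mathbf{x}|=(|x_1|,\dots,|x_n|)$, let $\|\cdot\|$ be the Euclidean norm, and let $\mathbb{R}[\mathbf{x},|\mathbf{x}|]$ be the unital algebra of functions on $\mathbb{R}^n$ generated by $x_1,\dots,x_n,|x_1|,\dots,|x_n|$. Let $\mathbf{y}=(y_1,\dots,y_{2n})$, and let $\Sigma\mathbb{R}[\mathbf{y}]^2$ be the set of finite sums of squares of polynomials in $\mathbb{R}[\mathbf{y}]$. Let $g_1,\dots,g_m\in\mathbb{R}[\mathbf{y}]$ be such that $$\mathbf{K}=\{\mathbf{x}\in\mathbb{R}^n : g_j(\mathbf{x},|\mathbf{x}|)\ge 0,\ j=1,\dots,m\}$$ is compact, and let $f\in\mathbb{R}[\mathbf{x},|\mathbf{x}|]$ be (strictly) positive on $\mathbf{K}$. Then there are $\sigma,\sigma_0,\sigma_1,\dots,\sigma_n,\psi_1,\dots,\psi_m\in\Sigma\mathbb{R}[\mathbf{y}]^2$ such that, for all $\mathbf{x}\in\mathbb{R}^n$, $$f(\mathbf{x})=\sigma(\mathbf{x},|\mathbf{x}|)+(n-\|\mathbf{x}\|^2)\,\sigma_0(\mathbf{x},|\mathbf{x}|)+\sum_{i=1}^n|x_i|\,\sigma_i(\mathbf{x},|\mathbf{x}|)+\sum_{j=1}^m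 g_j(\mathbf{x},|\mathbf{x}|)\,\psi_j(\mathbf{x},|\mathbf{x}|).$$ Moreover, for every $M\in\mathbb{R}$ such that $M-\|\mathbf{x}\|^2-\sum_{i=1}^n|x_i|^2>0$ for all $\mathbf{x}\in\mathbf{K}$, there is also such a representation (with other $\sigma,\sigma_0,\sigma_i,\psi_j\in\Sigma\mathbb{R}[\mathbf{y}]^2$) in which the factor $n-\|\mathbf{x}\|^2$ is replaced by $M-\|\mathbf{x}\|^2-\sum_{i=1}^n|x_i|^2=M-2\|\mathbf{x}\|^2$. -/

import Mathlib

/-- The algebra `ℝ[x,|x|]`: the unital algebra of functions on `ℝⁿ` generated by the coordinate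
functions `x_i` and their absolute values `|x_i|`. -/
def absAlgebra (n : ℕ) : Subalgebra ℝ (EuclideanSpace ℝ (Fin n) → ℝ) :=
  Algebra.adjoin ℝ
    (Set.range (fun (i : Fin n) (x : EuclideanSpace ℝ (Fin n)) => x i) ∪
      Set.range (fun (i : Fin n) (x : EuclideanSpace ℝ (Fin n)) => |x i|))

/-- The value `p(x,|x|)` of a polynomial `p` in `2n` variables: the variable `Sum.inl i` (the
`i`-th one) is replaced by `x_i`, and `Sum.inr i` (the `(n+i)`-th one) by `|x_i|`. -/
noncomputable def evalAbs {n : ℕ} (p : MvPolynomial (Fin n ⊕ Fin n) ℝ)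
    (x : EuclideanSpace ℝ (Fin n)) : ℝ :=
  MvPolynomial.eval (Sum.elim (fun i => x i) (fun i => |x i|)) p

/-- The set `K = {x ∈ ℝⁿ : g_j(x,|x|) ≥ 0, j = 1, …, m}`. -/
def absSet {n m : ℕ} (g : Fin m → MvPolynomial (Fin n ⊕ Fin n) ℝ) :
    Set (EuclideanSpace ℝ (Fin n)) :=
  {x | ∀ j, 0 ≤ evalAbs (g j) x}

/-- `f` is a sum of squares in `(x,|x|)`, plus sum-of-squares multiples of the function `b`, of each
`|x_i|` and of each `g_j(x,|x|)`, the sums of squares being taken in the polynomial ring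
`ℝ[y_1, …, y_{2n}]`. -/
def HasAbsCertificate {n m : ℕ} (g : Fin m → MvPolynomial (Fin n ⊕ Fin n) ℝ)
    (b f : EuclideanSpace ℝ (Fin n) → ℝ) : Prop :=
  ∃ (σ σ₀ : MvPolynomial (Fin n ⊕ Fin n) ℝ)
    (τ : Fin n → MvPolynomial (Fin n ⊕ Fin n) ℝ)
    (ψ : Fin m → MvPolynomial (Fin n ⊕ Fin n) ℝ),
    IsSumSq σ ∧ IsSumSq σ₀ ∧ (∀ i, IsSumSq (τ i)) ∧ (∀ j, IsSumSq (ψ j)) ∧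
    ∀ x : EuclideanSpace ℝ (Fin n),
      f x = evalAbs σ x + b x * evalAbs σ₀ x
        + ∑ i, |x i| * evalAbs (τ i) x
        + ∑ j, evalAbs (g j) x * evalAbs (ψ j) x

/-! The polynomials `p` in the `2n` variables for which `p(x,|x|)` has a certificate form a
quadratic module `Q`. The base factor bounds every squared coordinate modulo `Q`, so `Q` is
Archimedean. A certificate is an identity of functions, so `Q` contains plus and minus every
polynomial vanishing on the graph of `x ↦ |x|`. A character nonnegative on `Q` therefore respects
`|x_i|² = x_i²`; since `|x_i|` and the `g_j` also lie in `Q`, it is evaluation at `(x,|x|)` for some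
`x` in `K`.

It remains to separate `f ∉ Q` from `Q` by a character (`exists_character_nonpos`). Riesz extension
yields a state nonpositive at `f`. The states form a compact set, so Krein–Milman gives an extreme
state minimizing the value at `f`, and extreme states are multiplicative
(`map_mul_of_mem_extremePoints`). This last fact rests on the estimate `apply_sq_mul_le`. -/

section PureStates

/-- A sequence that is at least squared at each step, up to the factor `d`, and grows no faster than
`N ^ 2 ^ k` starts at no more than `N * d`. -/
theorem le_mul_of_sq_le_mul_succ {x : ℕ → ℝ} {d N C : ℝ} (hN : 0 < N) (hd : 0 ≤ d)
    (hx : ∀ k, x k ^ 2 ≤ d * x (k + 1)) (hC : ∀ k, x k ≤ C * N ^ 2 ^ k) : x 0 ≤ N * d := by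
  by_contra! h
  have hx0 : 0 < x 0 := lt_of_le_of_lt (by positivity) h
  rcases hd.eq_or_lt with rfl | hd
  · have := hx 0
    nlinarith
  set r := x 0 / (N * d) with hr
  have hr1 : 1 < r := by rwa [hr, one_lt_div (by positivity)]
  -- Squaring doubles the exponent, so an initial excess ratio `r > 1` becomes `r ^ 2 ^ k`, which no
  -- constant `C` absorbs.
  have key : ∀ k, d * (r * N) ^ 2 ^ k ≤ x k := by
    intro k
    induction k with
    | zero =>
      rw [hr, pow_zero, pow_one]
      apply le_of_eq
      field_simp
    | succ k ih =>
      have h0 : 0 ≤ d * (r * N) ^ 2 ^ k := by positivity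
      have h1 : (d * (r * N) ^ 2 ^ k) ^ 2 ≤ d * x (k + 1) :=
        (pow_le_pow_left₀ h0 ih 2).trans (hx k)
      have h2 : (d * (r * N) ^ 2 ^ k) ^ 2 = d * (d * (r * N) ^ 2 ^ (k + 1)) := by ring
      rw [h2] at h1
      exact le_of_mul_le_mul_left h1 hd
  obtain ⟨k, hk⟩ := pow_unbounded_of_one_lt (C / d) hr1
  have h1 : C / d < r ^ 2 ^ k := hk.trans_le (pow_le_pow_right₀ hr1.le Nat.lt_two_pow_self.le)
  have h2 := (key k).trans (hC k)
  rw [mul_pow, ← mul_assoc] at h2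
  have h3 : d * r ^ 2 ^ k ≤ C := le_of_mul_le_mul_right h2 (by positivity)
  rw [div_lt_iff₀ hd] at h1
  linarith

variable {A : Type*} [CommRing A] [Algebra ℝ A]

/-- The Cauchy–Schwarz inequality for a functional that is nonnegative on squares. -/
theorem sq_le_mul_of_nonneg_on_squares (φ : A →ₗ[ℝ] ℝ) (hφ : ∀ p, 0 ≤ φ (p * p)) (p : A) :
    φ p ^ 2 ≤ φ 1 * φ (p * p) := by
  have h : ∀ t : ℝ, 0 ≤ φ 1 * (t * t) + 2 * φ p * t + φ (p * p) := by
    intro t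
    have h1 : (t • (1 : A) + p) * (t • (1 : A) + p) = (t * t) • (1 : A) + (2 * t) • p + p * p := by
      simp only [Algebra.smul_def, map_mul, map_ofNat]
      ring
    have h2 := hφ (t • (1 : A) + p)
    rw [h1] at h2
    simp only [map_add, map_smul, smul_eq_mul] at h2
    linarith
  have := discrim_le_zero h
  rw [discrim] at this
  nlinarith

/-! ### Archimedean quadratic modules -/

/-- An Archimedean quadratic module in a commutative real algebra. -/
structure IsArchimedeanQuadraticModule (Q : PointedCone ℝ A) : Prop where
  one_mem : 1 ∈ Q
  sq_mul_mem : ∀ a, ∀ q ∈ Q, a * a * q ∈ Q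
  exists_sub_sq_mem : ∀ a, ∃ N : ℝ, 0 < N ∧ N • (1 : A) - a * a ∈ Q

namespace IsArchimedeanQuadraticModule

variable {Q : PointedCone ℝ A}

theorem sq_mem (hQ : IsArchimedeanQuadraticModule Q) (a : A) : a * a ∈ Q := by
  simpa using hQ.sq_mul_mem a 1 hQ.one_mem

theorem smul_mem (_hQ : IsArchimedeanQuadraticModule Q) {c : ℝ} (hc : 0 ≤ c) {q : A} (hq : q ∈ Q) :
    c • q ∈ Q :=
  Submodule.smul_mem Q (⟨c, hc⟩ : {c : ℝ // 0 ≤ c}) hq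

/-- Completing the square: `N + 1/4 - a = (N - a²) + (a - 1/2)²`. -/
theorem exists_sub_mem (hQ : IsArchimedeanQuadraticModule Q) (a : A) :
    ∃ N : ℝ, 0 < N ∧ N • (1 : A) - a ∈ Q := by
  obtain ⟨N, hN, h⟩ := hQ.exists_sub_sq_mem a
  refine ⟨N + 1 / 4, by positivity, ?_⟩
  have h1 : (N + 1 / 4) • (1 : A) - a
      = (N • (1 : A) - a * a) + (a - (1 / 2 : ℝ) • 1) * (a - (1 / 2 : ℝ) • 1) := by
    have h2 : (a - (1 / 2 : ℝ) • (1 : A)) * (a - (1 / 2 : ℝ) • 1)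
        = a * a - (2 * (1 / 2) : ℝ) • a + (1 / 2 * (1 / 2) : ℝ) • 1 := by
      simp only [Algebra.smul_def, map_mul, map_ofNat]
      ring
    rw [h2, add_smul]
    norm_num
    abel
  rw [h1]
  exact Q.add_mem h (hQ.sq_mem _)

/-- A functional nonnegative on `Q` is nonnegative on `(N - a²) * Q` whenever `N - a² ∈ Q`. -/
theorem apply_sq_mul_le (hQ : IsArchimedeanQuadraticModule Q) (L : A →ₗ[ℝ] ℝ)
    (hL : ∀ q ∈ Q, 0 ≤ L q) {N : ℝ} (hN : 0 < N) {a : A} (ha : N • (1 : A) - a * a ∈ Q)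
    {b : A} (hb : b ∈ Q) : L (a * a * b) ≤ N * L b := by
  -- `Q` need not be closed under products, so `(N - a²) * b` may lie outside it. Instead,
  -- Cauchy–Schwarz for `p ↦ L (p * b)` is iterated along the powers `a ^ 2 ^ k`, against the crude
  -- growth bound `B * L 1 * N ^ m`.
  obtain ⟨B, hB, hBb⟩ := hQ.exists_sub_mem b
  have hpow : ∀ m : ℕ, L (a ^ m * a ^ m) ≤ N ^ m * L 1 := by
    intro m
    induction m with
    | zero => simp
    | succ m ih =>
      have h := hL _ (hQ.sq_mul_mem (a ^ m) _ ha)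
      have h1 : a ^ m * a ^ m * (N • (1 : A) - a * a)
          = N • (a ^ m * a ^ m) - a ^ (m + 1) * a ^ (m + 1) := by
        rw [mul_sub, mul_smul_comm, mul_one]
        ring
      rw [h1, map_sub, map_smul, smul_eq_mul] at h
      calc L (a ^ (m + 1) * a ^ (m + 1)) ≤ N * L (a ^ m * a ^ m) := by linarith
        _ ≤ N * (N ^ m * L 1) := by gcongr
        _ = N ^ (m + 1) * L 1 := by ring
  have hbound : ∀ m : ℕ, L (a ^ m * a ^ m * b) ≤ (B * L 1) * N ^ m := by
    intro m
    have h := hL _ (hQ.sq_mul_mem (a ^ m) _ hBb)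
    rw [mul_sub, mul_smul_comm, mul_one, map_sub, map_smul, smul_eq_mul] at h
    calc L (a ^ m * a ^ m * b) ≤ B * L (a ^ m * a ^ m) := by linarith
      _ ≤ B * (N ^ m * L 1) := by gcongr; exact hpow m
      _ = _ := by ring
  have hcs := sq_le_mul_of_nonneg_on_squares (L ∘ₗ LinearMap.mulRight ℝ b)
    (fun p => hL _ (hQ.sq_mul_mem p b hb))
  simp only [LinearMap.comp_apply, LinearMap.mulRight_apply, one_mul] at hcs
  have := le_mul_of_sq_le_mul_succ (x := fun k => L (a ^ 2 ^ k * a ^ 2 ^ k * b)) (d := L b)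
    (C := B * L 1) hN (hL b hb) (fun k => ?_) (fun k => hbound _)
  · simpa using this
  · have h := hcs (a ^ 2 ^ k * a ^ 2 ^ k)
    have h1 : a ^ 2 ^ (k + 1) = a ^ 2 ^ k * a ^ 2 ^ k := by ring
    simpa only [h1] using h

end IsArchimedeanQuadraticModule

/-! ### States, extreme states and characters -/

/-- The states of `Q`: normalized linear functionals that are nonnegative on `Q`, as a subset of the
product space `A → ℝ`. -/
def stateSet (Q : PointedCone ℝ A) : Set (A → ℝ) :=
  {L | ∃ l : A →ₗ[ℝ] ℝ, (∀ q ∈ Q, 0 ≤ l q) ∧ l 1 = 1 ∧ ⇑l = L}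

namespace IsArchimedeanQuadraticModule

variable {Q : PointedCone ℝ A}

/-- Tychonoff: the conditions are closed, and `N(±a) - (±a) ∈ Q` confines each value to an interval.
-/
theorem isCompact_stateSet (hQ : IsArchimedeanQuadraticModule Q) : IsCompact (stateSet Q) := by
  choose N _ hN using hQ.exists_sub_mem
  refine (isCompact_univ_pi (s := fun a => Set.Icc (-N (-a)) (N a))
    (fun a => isCompact_Icc)).of_isClosed_subset ?_ ?_
  · have h : stateSet Q = (⋂ (a : A) (b : A), {L : A → ℝ | L (a + b) = L a + L b}) ∩
        (⋂ (c : ℝ) (a : A), {L : A → ℝ | L (c • a) = c * L a}) ∩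
        (⋂ q ∈ Q, {L : A → ℝ | 0 ≤ L q}) ∩ {L : A → ℝ | L 1 = 1} := by
      ext L
      simp only [stateSet, Set.mem_ofPred_eq, Set.mem_inter_iff, Set.mem_iInter]
      constructor
      · rintro ⟨l, h1, h2, rfl⟩
        exact ⟨⟨⟨map_add l, fun c a => by simp⟩, h1⟩, h2⟩
      · rintro ⟨⟨⟨h1, h2⟩, h3⟩, h4⟩
        exact ⟨{ toFun := L, map_add' := h1, map_smul' := h2 }, h3, h4, rfl⟩
    rw [h]
    refine IsClosed.inter (IsClosed.inter (IsClosed.inter ?_ ?_) ?_) ?_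
    · exact isClosed_iInter fun a => isClosed_iInter fun b =>
        isClosed_eq (by fun_prop) (by fun_prop)
    · exact isClosed_iInter fun c => isClosed_iInter fun a =>
        isClosed_eq (by fun_prop) (by fun_prop)
    · exact isClosed_biInter fun q _ => isClosed_le (by fun_prop) (by fun_prop)
    · exact isClosed_eq (by fun_prop) (by fun_prop)
  · rintro _ ⟨l, h1, h2, rfl⟩ a -
    have h3 := h1 _ (hN a)
    have h4 := h1 _ (hN (-a))
    simp only [map_sub, map_smul, map_neg, h2, smul_eq_mul, mul_one] at h3 h4
    constructor <;> linarith

/-- An element outside `Q` is separated from `Q` by a state. -/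
theorem exists_state_nonpos (hQ : IsArchimedeanQuadraticModule Q) {f : A} (hf : f ∉ Q) :
    ∃ L ∈ stateSet Q, L f ≤ 0 := by
  have hneg : (-1 : A) ∉ Q := by
    intro h
    obtain ⟨N, hN, hNf⟩ := hQ.exists_sub_mem (-f)
    apply hf
    have := Q.add_mem hNf (hQ.smul_mem hN.le h)
    simpa using this
  -- A positive functional on the enlarged cone is automatically nonpositive at `f`. If `q - t f =
  -- -1` with `t > 0`, then `f = (q + 1) / t` would lie in `Q`, so `-1` stays outside.
  let Q' : PointedCone ℝ A := Q ⊔ PointedCone.hull ℝ {-f}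
  have hQQ' : Q ≤ Q' := le_sup_left
  have hfQ' : -f ∈ Q' := (le_sup_right : _ ≤ Q') (Submodule.mem_span_singleton_self _)
  have hneg' : (-1 : A) ∉ Q' := by
    intro h
    obtain ⟨q, hq, z, hz, hqz⟩ := Submodule.mem_sup.1 h
    obtain ⟨⟨t, ht⟩, rfl⟩ := Submodule.mem_span_singleton.1 hz
    change q + t • (-f) = -1 at hqz
    change 0 ≤ t at ht
    rcases ht.eq_or_lt with rfl | ht
    · apply hneg
      rw [← hqz]
      simpa using hq
    · apply hf
      have h1 : f = t⁻¹ • (q + 1) := by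
        have h2 : q + 1 = t • f := by
          rw [smul_neg] at hqz
          linear_combination hqz
        rw [h2, smul_smul, inv_mul_cancel₀ ht.ne', one_smul]
      rw [h1]
      exact hQ.smul_mem (by positivity) (Q.add_mem hq hQ.one_mem)
  have hone : (1 : A) ≠ 0 := by
    intro h
    apply hneg
    rw [h, neg_zero]
    exact Q.zero_mem
  obtain ⟨l, hl1, hl2⟩ := riesz_extension Q' (LinearPMap.mkSpanSingleton (1 : A) (1 : ℝ) hone)
    (by
      rintro ⟨x, hx⟩ hxQ
      obtain ⟨c, rfl⟩ := Submodule.mem_span_singleton.1 hx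
      rw [LinearPMap.mkSpanSingleton'_apply, smul_eq_mul, mul_one]
      change 0 ≤ c
      by_contra! hc
      apply hneg'
      have h1 := Submodule.smul_mem Q' (⟨(-c)⁻¹, by simpa using hc.le⟩ : {c : ℝ // 0 ≤ c}) hxQ
      change (-c)⁻¹ • (c • (1 : A)) ∈ Q' at h1
      rw [smul_smul, inv_neg, neg_mul, inv_mul_cancel₀ hc.ne, neg_smul, one_smul] at h1
      exact h1)
    (by
      intro y
      obtain ⟨N, hN, h⟩ := hQ.exists_sub_mem (-y)
      refine ⟨⟨N • 1, Submodule.mem_span_singleton.2 ⟨N, rfl⟩⟩, hQQ' ?_⟩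
      simpa using h)
  refine ⟨l, ⟨l, fun q hq => hl2 q (hQQ' hq), ?_, rfl⟩, ?_⟩
  · exact (hl1 ⟨1, Submodule.mem_span_singleton_self _⟩).trans
      (LinearPMap.mkSpanSingleton_apply ℝ ℝ hone 1)
  · have := hl2 _ hfQ'
    rw [map_neg] at this
    linarith

/-- Extreme states are multiplicative. -/
theorem map_mul_of_mem_extremePoints (hQ : IsArchimedeanQuadraticModule Q) {l : A →ₗ[ℝ] ℝ}
    (hl : ⇑l ∈ (stateSet Q).extremePoints ℝ) (a b : A) : l (a * b) = l a * l b := by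
  obtain ⟨l', hpos, hone, hl'⟩ := hl.1
  rw [DFunLike.coe_injective hl'] at hpos hone
  clear hl' l'
  have hsq : ∀ a b, l (a * a * b) = l (a * a) * l b := by
    clear a b
    intro a b
    obtain ⟨N, hN, ha⟩ := hQ.exists_sub_sq_mem a
    have hN1 := hpos _ ha
    simp only [map_sub, map_smul, hone, smul_eq_mul, mul_one] at hN1
    have ha0 := hpos _ (hQ.sq_mem a)
    -- `l` is a convex combination of the normalizations of `l ((a² + 1) ·)` and `l ((N + 1 - a²)
    -- ·)`; the added `1`s keep both normalizers positive. Extremality forces `l = l₁`.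
    let l₁ : A →ₗ[ℝ] ℝ := (l (a * a) + 1)⁻¹ • (l ∘ₗ LinearMap.mulLeft ℝ (a * a) + l)
    let l₂ : A →ₗ[ℝ] ℝ :=
      (N + 1 - l (a * a))⁻¹ • ((N + 1) • l - l ∘ₗ LinearMap.mulLeft ℝ (a * a))
    have e₁ : ∀ x, l₁ x = (l (a * a) + 1)⁻¹ * (l (a * a * x) + l x) := fun x => rfl
    have e₂ : ∀ x, l₂ x = (N + 1 - l (a * a))⁻¹ * ((N + 1) * l x - l (a * a * x)) := fun x => rfl
    have p₁ : 0 < l (a * a) + 1 := by linarith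
    have p₂ : 0 < N + 1 - l (a * a) := by linarith
    have m₁ : ⇑l₁ ∈ stateSet Q := by
      refine ⟨l₁, fun q hq => ?_, ?_, rfl⟩
      · have h1 := hpos _ hq
        have h2 := hpos _ (hQ.sq_mul_mem a q hq)
        rw [e₁]
        positivity
      · rw [e₁, mul_one, hone, inv_mul_cancel₀ p₁.ne']
    have m₂ : ⇑l₂ ∈ stateSet Q := by
      refine ⟨l₂, fun q hq => ?_, ?_, rfl⟩
      · have h1 := hpos _ hq
        have h2 := hQ.apply_sq_mul_le l hpos hN ha hq
        rw [e₂]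
        have : 0 ≤ (N + 1) * l q - l (a * a * q) := by linarith
        positivity
      · rw [e₂, mul_one, hone, mul_one, inv_mul_cancel₀ p₂.ne']
    have hseg : ⇑l ∈ openSegment ℝ (⇑l₁) (⇑l₂) := by
      refine ⟨(l (a * a) + 1) / (N + 2), (N + 1 - l (a * a)) / (N + 2), by positivity,
        by positivity, ?_, ?_⟩
      · field_simp
        ring
      · funext x
        simp only [Pi.add_apply, Pi.smul_apply, smul_eq_mul, e₁, e₂]
        field_simp
        ring
    have h := congrFun ((mem_extremePoints.1 hl).2 _ m₁ _ m₂ hseg).1 b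
    rw [e₁, inv_mul_eq_iff_eq_mul₀ p₁.ne'] at h
    linarith
  -- Polarization: expanding at `a + 1` isolates the cross term `2ab`.
  have h1 := hsq (a + 1) b
  have h2 := hsq a b
  have h3 : (a + 1) * (a + 1) * b = a * a * b + (2 : ℝ) • (a * b) + b := by
    simp only [Algebra.smul_def, map_ofNat]
    ring
  have h4 : (a + 1) * (a + 1) = a * a + (2 : ℝ) • a + 1 := by
    simp only [Algebra.smul_def, map_ofNat]
    ring
  rw [h3, h4] at h1
  simp only [map_add, map_smul, smul_eq_mul, hone] at h1
  linarith

/-- The abstract Archimedean Positivstellensatz: an element outside `Q` is nonpositive at some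
character that is nonnegative on `Q`. -/
theorem exists_character_nonpos (hQ : IsArchimedeanQuadraticModule Q) {f : A} (hf : f ∉ Q) :
    ∃ φ : A →ₐ[ℝ] ℝ, (∀ q ∈ Q, 0 ≤ φ q) ∧ φ f ≤ 0 := by
  obtain ⟨L₀, hL₀, hL₀f⟩ := hQ.exists_state_nonpos hf
  obtain ⟨L₁, hL₁, hmin⟩ := hQ.isCompact_stateSet.exists_isMinOn ⟨L₀, hL₀⟩
    (f := fun L => L f) (by fun_prop)
  -- The minimizers of evaluation at `f` form a face, so an extreme point of `F` is an extreme
  -- state.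
  let F : Set (A → ℝ) := stateSet Q ∩ {L | L f = L₁ f}
  have hF : IsCompact F :=
    hQ.isCompact_stateSet.inter_right (isClosed_eq (by fun_prop) (by fun_prop))
  have hext : IsExtreme ℝ (stateSet Q) F := by
    refine ⟨Set.inter_subset_left, ?_⟩
    rintro x hx y hy z ⟨hz, hzf⟩ ⟨s, t, hs, ht, hst, rfl⟩
    refine ⟨hx, ?_⟩
    have h1 : L₁ f ≤ x f := hmin hx
    have h2 : L₁ f ≤ y f := hmin hy
    simp only [Set.mem_ofPred_eq, Pi.add_apply, Pi.smul_apply, smul_eq_mul] at hzf ⊢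
    have h3 : s * (x f - L₁ f) + t * (y f - L₁ f) = 0 := by
      linear_combination hzf - L₁ f * hst
    have h4 : 0 ≤ t * (y f - L₁ f) := mul_nonneg ht.le (by linarith)
    nlinarith
  obtain ⟨L, hL⟩ := hF.extremePoints_nonempty ⟨L₁, hL₁, rfl⟩
  have hLf : L f = L₁ f := hL.1.2
  have hLext := hext.extremePoints_subset_extremePoints hL
  obtain ⟨l, hpos, hone, rfl⟩ := hL.1.1
  refine ⟨AlgHom.ofLinearMap l hone (hQ.map_mul_of_mem_extremePoints hLext), hpos, ?_⟩
  have : L₁ f ≤ L₀ f := hmin hL₀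
  change l f ≤ 0
  linarith

end IsArchimedeanQuadraticModule

end PureStates

/-! ### The cone of certificates and its characters -/

section Certificates

variable {n m : ℕ} {g : Fin m → MvPolynomial (Fin n ⊕ Fin n) ℝ}

theorem evalAbs_add (p q : MvPolynomial (Fin n ⊕ Fin n) ℝ) (x : EuclideanSpace ℝ (Fin n)) :
    evalAbs (p + q) x = evalAbs p x + evalAbs q x :=
  map_add _ p q

theorem evalAbs_mul (p q : MvPolynomial (Fin n ⊕ Fin n) ℝ) (x : EuclideanSpace ℝ (Fin n)) :
    evalAbs (p * q) x = evalAbs p x * evalAbs q x :=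
  map_mul _ p q

theorem evalAbs_zero (x : EuclideanSpace ℝ (Fin n)) :
    evalAbs (0 : MvPolynomial (Fin n ⊕ Fin n) ℝ) x = 0 :=
  map_zero _

theorem evalAbs_one (x : EuclideanSpace ℝ (Fin n)) :
    evalAbs (1 : MvPolynomial (Fin n ⊕ Fin n) ℝ) x = 1 :=
  map_one _

theorem isSumSq_C {c : ℝ} (hc : 0 ≤ c) :
    IsSumSq (MvPolynomial.C c : MvPolynomial (Fin n ⊕ Fin n) ℝ) := by
  have h := IsSumSq.mul_self (MvPolynomial.C (√c) : MvPolynomial (Fin n ⊕ Fin n) ℝ)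
  rwa [← map_mul, Real.mul_self_sqrt hc] at h

namespace HasAbsCertificate

variable {b f h : EuclideanSpace ℝ (Fin n) → ℝ}

theorem add (hf : HasAbsCertificate g b f) (hh : HasAbsCertificate g b h) :
    HasAbsCertificate g b (f + h) := by
  obtain ⟨σ, σ₀, τ, ψ, h1, h2, h3, h4, h5⟩ := hf
  obtain ⟨σ', σ₀', τ', ψ', h1', h2', h3', h4', h5'⟩ := hh
  refine ⟨σ + σ', σ₀ + σ₀', τ + τ', ψ + ψ', h1.add h1', h2.add h2', fun i => (h3 i).add (h3' i),
    fun j => (h4 j).add (h4' j), fun x => ?_⟩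
  simp only [Pi.add_apply, h5, h5', evalAbs_add, mul_add, Finset.sum_add_distrib]
  ring

theorem evalAbs_mul {s : MvPolynomial (Fin n ⊕ Fin n) ℝ} (hs : IsSumSq s)
    (hf : HasAbsCertificate g b f) : HasAbsCertificate g b (evalAbs s * f) := by
  obtain ⟨σ, σ₀, τ, ψ, h1, h2, h3, h4, h5⟩ := hf
  refine ⟨s * σ, s * σ₀, fun i => s * τ i, fun j => s * ψ j, hs.mul h1, hs.mul h2,
    fun i => hs.mul (h3 i), fun j => hs.mul (h4 j), fun x => ?_⟩
  simp only [Pi.mul_apply, h5, _root_.evalAbs_mul, mul_add, Finset.mul_sum]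
  congr 1
  · congr 1
    · ring
    · exact Finset.sum_congr rfl fun i _ => by ring
  · exact Finset.sum_congr rfl fun i _ => by ring

theorem of_isSumSq {s : MvPolynomial (Fin n ⊕ Fin n) ℝ} (hs : IsSumSq s)
    (h : ∀ x, f x = evalAbs s x) : HasAbsCertificate g b f :=
  ⟨s, 0, 0, 0, hs, .zero, fun _ => .zero, fun _ => .zero, fun x => by simp [h, evalAbs_zero]⟩

theorem base : HasAbsCertificate g b b :=
  ⟨0, 1, 0, 0, .zero, by simp, fun _ => .zero, fun _ => .zero,
    fun x => by simp [evalAbs_zero, evalAbs_one]⟩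

theorem abs_coord (i : Fin n) : HasAbsCertificate g b (fun x => |x i|) := by
  refine ⟨0, 0, Pi.single i 1, 0, .zero, .zero, fun k => ?_, fun _ => .zero, fun x => ?_⟩
  · rcases eq_or_ne k i with rfl | hk
    · simp
    · simp [hk]
  · rw [Finset.sum_eq_single i]
    · simp [evalAbs_zero, evalAbs_one]
    · intro k _ hk
      simp [hk, evalAbs_zero]
    · simp

theorem constraint (j : Fin m) : HasAbsCertificate g b (evalAbs (g j)) := by
  refine ⟨0, 0, 0, Pi.single j 1, .zero, .zero, fun _ => .zero, fun k => ?_, fun x => ?_⟩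
  · rcases eq_or_ne k j with rfl | hk
    · simp
    · simp [hk]
  · rw [Finset.sum_eq_single j]
    · simp [evalAbs_zero, evalAbs_one]
    · intro k _ hk
      simp [hk, evalAbs_zero]
    · simp

end HasAbsCertificate

/-- The polynomials `p` for which `p(x,|x|)` has a certificate. -/
def certificateCone (g : Fin m → MvPolynomial (Fin n ⊕ Fin n) ℝ)
    (b : EuclideanSpace ℝ (Fin n) → ℝ) : PointedCone ℝ (MvPolynomial (Fin n ⊕ Fin n) ℝ) where
  carrier := {p | HasAbsCertificate g b (evalAbs p)}
  add_mem' {p q} hp hq := by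
    have h := HasAbsCertificate.add hp hq
    rwa [← show evalAbs (p + q) = evalAbs p + evalAbs q from funext (evalAbs_add p q)] at h
  zero_mem' := HasAbsCertificate.of_isSumSq .zero fun _ => rfl
  smul_mem' c p hp := by
    have h := HasAbsCertificate.evalAbs_mul (isSumSq_C c.2) hp
    rw [← show evalAbs (MvPolynomial.C c.1 * p) = evalAbs (MvPolynomial.C c.1) * evalAbs p from
      funext (evalAbs_mul _ p), ← MvPolynomial.smul_eq_C_mul] at h
    exact h

theorem mem_certificateCone {b : EuclideanSpace ℝ (Fin n) → ℝ}
    {p : MvPolynomial (Fin n ⊕ Fin n) ℝ} :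
    p ∈ certificateCone g b ↔ HasAbsCertificate g b (evalAbs p) :=
  Iff.rfl

theorem mul_mem_certificateCone {b : EuclideanSpace ℝ (Fin n) → ℝ}
    {s p : MvPolynomial (Fin n ⊕ Fin n) ℝ} (hs : IsSumSq s) (hp : p ∈ certificateCone g b) :
    s * p ∈ certificateCone g b := by
  have h := HasAbsCertificate.evalAbs_mul hs hp
  rwa [← show evalAbs (s * p) = evalAbs s * evalAbs p from funext (evalAbs_mul s p)] at h

theorem mem_certificateCone_of_isSumSq {b : EuclideanSpace ℝ (Fin n) → ℝ}
    {s : MvPolynomial (Fin n ⊕ Fin n) ℝ} (hs : IsSumSq s) : s ∈ certificateCone g b :=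
  HasAbsCertificate.of_isSumSq hs fun _ => rfl

/-- If each squared coordinate is bounded modulo certificates, so is the square of every
polynomial. -/
theorem isArchimedeanQuadraticModule_certificateCone {b : EuclideanSpace ℝ (Fin n) → ℝ} {N : ℝ}
    (hb : ∀ i, HasAbsCertificate g b (fun x => N - x i ^ 2)) :
    IsArchimedeanQuadraticModule (certificateCone g b) := by
  have hmul : ∀ {c : ℝ} {p : MvPolynomial (Fin n ⊕ Fin n) ℝ}, 0 ≤ c → p ∈ certificateCone g b →
      MvPolynomial.C c * p ∈ certificateCone g b :=
    fun hc hp => mul_mem_certificateCone (isSumSq_C hc) hp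
  have hC : ∀ {c : ℝ}, 0 ≤ c → MvPolynomial.C c ∈ certificateCone g b :=
    fun hc => mem_certificateCone_of_isSumSq (isSumSq_C hc)
  have hweak : ∀ {c d : ℝ} {p : MvPolynomial (Fin n ⊕ Fin n) ℝ}, c ≤ d →
      MvPolynomial.C c - p ∈ certificateCone g b → MvPolynomial.C d - p ∈ certificateCone g b := by
    intro c d p hcd hp
    have h := (certificateCone g b).add_mem hp (hC (sub_nonneg.2 hcd))
    rw [map_sub] at h
    convert h using 1
    ring
  have harch : ∀ p : MvPolynomial (Fin n ⊕ Fin n) ℝ,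
      ∃ c : ℝ, 0 < c ∧ MvPolynomial.C c - p * p ∈ certificateCone g b := by
    intro p
    have hX : ∀ k : Fin n ⊕ Fin n, ∃ c : ℝ, 0 < c ∧
        MvPolynomial.C c - MvPolynomial.X k * MvPolynomial.X k ∈ certificateCone g b := by
      intro k
      refine ⟨|N| + 1, by positivity, hweak (c := N) (by linarith [le_abs_self N]) ?_⟩
      rw [mem_certificateCone]
      rcases k with i | i
      · convert hb i using 1
        funext x
        simp [evalAbs, sq]
      -- The same bound serves the variable standing for `|x_i|`, as `|x_i|² = x_i²`.
      · convert hb i using 1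
        funext x
        simp [evalAbs, sq]
    have hprod : ∀ p q : MvPolynomial (Fin n ⊕ Fin n) ℝ,
        (∃ c : ℝ, 0 < c ∧ MvPolynomial.C c - p * p ∈ certificateCone g b) →
        (∃ c : ℝ, 0 < c ∧ MvPolynomial.C c - q * q ∈ certificateCone g b) →
        ∃ c : ℝ, 0 < c ∧ MvPolynomial.C c - (p * q) * (p * q) ∈ certificateCone g b := by
      rintro p q ⟨c, hc, hp⟩ ⟨d, hd, hq⟩
      refine ⟨c * d, by positivity, ?_⟩
      -- `cd - p²q² = q²(c - p²) + c(d - q²)`.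
      have h := (certificateCone g b).add_mem
        (mul_mem_certificateCone (IsSumSq.mul_self q) hp) (hmul hc.le hq)
      convert h using 1
      rw [map_mul]
      ring
    induction p using MvPolynomial.induction_on with
    | C a =>
      refine ⟨a ^ 2 + 1, by positivity, ?_⟩
      have h := hC (c := 1) zero_le_one
      convert h using 1
      simp only [map_add, map_pow]
      ring
    | add p q hp hq =>
      obtain ⟨c, hc, hp⟩ := hp
      obtain ⟨d, hd, hq⟩ := hq
      refine ⟨2 * c + 2 * d, by positivity, ?_⟩
      -- `2c + 2d - (p + q)² = 2(c - p²) + 2(d - q²) + (p - q)²`.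
      have h := (certificateCone g b).add_mem
        ((certificateCone g b).add_mem (hmul zero_le_two hp) (hmul zero_le_two hq))
        (mem_certificateCone_of_isSumSq (IsSumSq.mul_self (p - q)))
      convert h using 1
      simp only [map_add, map_mul, map_ofNat]
      ring
    | mul_X p k hp => exact hprod _ _ hp (hX k)
  refine ⟨?_, fun a q hq => mul_mem_certificateCone (IsSumSq.mul_self a) hq, fun p => ?_⟩
  · simpa using hC (c := 1) zero_le_one
  · obtain ⟨c, hc, h⟩ := harch p
    refine ⟨c, hc, ?_⟩
    rwa [MvPolynomial.smul_eq_C_mul, mul_one]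

theorem exists_evalAbs_eq {f : EuclideanSpace ℝ (Fin n) → ℝ} (hf : f ∈ absAlgebra n) :
    ∃ p : MvPolynomial (Fin n ⊕ Fin n) ℝ, evalAbs p = f := by
  induction hf using Algebra.adjoin_induction with
  | mem f hf =>
    rcases hf with ⟨i, rfl⟩ | ⟨i, rfl⟩
    · exact ⟨MvPolynomial.X (Sum.inl i), by funext x; simp [evalAbs]⟩
    · exact ⟨MvPolynomial.X (Sum.inr i), by funext x; simp [evalAbs]⟩
  | algebraMap r => exact ⟨MvPolynomial.C r, by funext x; simp [evalAbs]⟩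
  | add f h _ _ hf hh =>
    obtain ⟨p, rfl⟩ := hf
    obtain ⟨q, rfl⟩ := hh
    exact ⟨p + q, funext fun x => evalAbs_add p q x⟩
  | mul f h _ _ hf hh =>
    obtain ⟨p, rfl⟩ := hf
    obtain ⟨q, rfl⟩ := hh
    exact ⟨p * q, funext fun x => evalAbs_mul p q x⟩

/-- A character that is nonnegative on the certificate cone is the evaluation at `(x,|x|)` for some
`x` in `K`. -/
theorem exists_eq_evalAbs_of_nonneg {b : EuclideanSpace ℝ (Fin n) → ℝ}
    (φ : MvPolynomial (Fin n ⊕ Fin n) ℝ →ₐ[ℝ] ℝ) (hφ : ∀ q ∈ certificateCone g b, 0 ≤ φ q) :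
    ∃ x ∈ absSet g, ∀ p, φ p = evalAbs p x := by
  let x : EuclideanSpace ℝ (Fin n) := WithLp.toLp 2 fun i => φ (MvPolynomial.X (Sum.inl i))
  -- Used for a polynomial and its negative, this shows that `φ` kills it.
  have hzero : ∀ p : MvPolynomial (Fin n ⊕ Fin n) ℝ, (∀ x, evalAbs p x = 0) → 0 ≤ φ p :=
    fun p hp => hφ _ (HasAbsCertificate.of_isSumSq .zero fun x => by rw [hp, evalAbs_zero])
  have habs : ∀ i, φ (MvPolynomial.X (Sum.inr i)) = |x i| := by
    intro i
    have h0 : 0 ≤ φ (MvPolynomial.X (Sum.inr i)) := by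
      refine hφ _ ?_
      rw [mem_certificateCone]
      convert HasAbsCertificate.abs_coord i using 1
      funext x
      simp [evalAbs]
    have h1 := hzero (MvPolynomial.X (Sum.inr i) ^ 2 - MvPolynomial.X (Sum.inl i) ^ 2)
      (fun x => by simp [evalAbs])
    have h2 := hzero (MvPolynomial.X (Sum.inl i) ^ 2 - MvPolynomial.X (Sum.inr i) ^ 2)
      (fun x => by simp [evalAbs])
    rw [map_sub, map_pow, map_pow] at h1 h2
    have h3 : φ (MvPolynomial.X (Sum.inr i)) ^ 2 = (x i) ^ 2 := by
      change _ = φ (MvPolynomial.X (Sum.inl i)) ^ 2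
      linarith
    rw [← abs_of_nonneg h0]
    exact (sq_eq_sq_iff_abs_eq_abs _ _).1 h3
  have heval : ∀ p, φ p = evalAbs p x := by
    have h : φ = MvPolynomial.aeval (Sum.elim (fun i => x i) (fun i => |x i|)) := by
      apply MvPolynomial.algHom_ext
      rintro (i | i)
      · simp [x]
      · simp [habs]
    intro p
    rw [h, MvPolynomial.aeval_eq_eval]
    rfl
  refine ⟨x, fun j => ?_, heval⟩
  rw [← heval]
  exact hφ _ (HasAbsCertificate.constraint j)

theorem hasAbsCertificate_of_pos {b f : EuclideanSpace ℝ (Fin n) → ℝ} {N : ℝ}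
    (hb : ∀ i, HasAbsCertificate g b (fun x => N - x i ^ 2)) (hf : f ∈ absAlgebra n)
    (hpos : ∀ x ∈ absSet g, 0 < f x) : HasAbsCertificate g b f := by
  obtain ⟨p, rfl⟩ := exists_evalAbs_eq hf
  by_contra hp
  obtain ⟨φ, hφ, hφp⟩ :=
    (isArchimedeanQuadraticModule_certificateCone hb).exists_character_nonpos hp
  obtain ⟨x, hx, h⟩ := exists_eq_evalAbs_of_nonneg φ hφ
  exact absurd (hpos x hx) (by rw [← h]; exact hφp.not_gt)

theorem isSumSq_sum_X_sq (s : Finset (Fin n)) :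
    IsSumSq (∑ i ∈ s, (MvPolynomial.X (Sum.inl i) * MvPolynomial.X (Sum.inl i) :
      MvPolynomial (Fin n ⊕ Fin n) ℝ)) :=
  IsSumSq.sum fun _ _ => IsSumSq.mul_self _

/-- A bound on the squared norm bounds each squared coordinate. -/
theorem HasAbsCertificate.sub_coord_sq (N : ℝ) (i : Fin n) :
    HasAbsCertificate g (fun x => N - ‖x‖ ^ 2) (fun x => N - x i ^ 2) := by
  -- Adding back the squares of the other coordinates leaves only `x i ^ 2`.
  convert HasAbsCertificate.add HasAbsCertificate.base
    (HasAbsCertificate.of_isSumSq (isSumSq_sum_X_sq (Finset.univ.erase i)) fun x => rfl) using 1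
  funext x
  have h := Finset.add_sum_erase Finset.univ (fun i => x i * x i) (Finset.mem_univ i)
  have hnorm := EuclideanSpace.real_norm_sq_eq x
  simp only [Pi.add_apply, evalAbs, map_sum, map_mul,
    MvPolynomial.eval_X, Sum.elim_inl, sq] at hnorm ⊢
  linarith

/-- A bound on the squared norm of `(x,|x|)` bounds each squared coordinate. -/
theorem HasAbsCertificate.sub_coord_sq_of_double (M : ℝ) (i : Fin n) :
    HasAbsCertificate g (fun x => M - ‖x‖ ^ 2 - ∑ i, |x i| ^ 2) (fun x => M - x i ^ 2) := by
  convert HasAbsCertificate.add HasAbsCertificate.base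
    (HasAbsCertificate.of_isSumSq ((isSumSq_sum_X_sq (Finset.univ.erase i)).add
      (isSumSq_sum_X_sq Finset.univ)) fun x => rfl) using 1
  funext x
  have h := Finset.add_sum_erase Finset.univ (fun i => x i * x i) (Finset.mem_univ i)
  have hnorm := EuclideanSpace.real_norm_sq_eq x
  simp only [Pi.add_apply, evalAbs, map_sum, map_mul, map_add,
    MvPolynomial.eval_X, Sum.elim_inl, sq, abs_mul_abs_self] at hnorm ⊢
  linarith

end Certificates

theorem mainTheorem10 (n m : ℕ) (g : Fin m → MvPolynomial (Fin n ⊕ Fin n) ℝ)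
    (hK : IsCompact (absSet g))
    (f : EuclideanSpace ℝ (Fin n) → ℝ) (hf : f ∈ absAlgebra n)
    (hpos : ∀ x ∈ absSet g, 0 < f x) :
    HasAbsCertificate g (fun x => (n : ℝ) - ‖x‖ ^ 2) f ∧
    ∀ M : ℝ, (∀ x ∈ absSet g, 0 < M - ‖x‖ ^ 2 - ∑ i, |x i| ^ 2) →
      HasAbsCertificate g (fun x => M - ‖x‖ ^ 2 - ∑ i, |x i| ^ 2) f :=
  ⟨hasAbsCertificate_of_pos (HasAbsCertificate.sub_coord_sq n) hf hpos,
    fun M _ => hasAbsCertificate_of_pos (HasAbsCertificate.sub_coord_sq_of_double M) hf hpos⟩
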